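/- Let $n\ge 5$, and let $K_n$ be the complete graph on $\{1,\dots,n\}$ with edge set $E$, $|E|=\binom n2$. Let $\mathcal F_n\subseteq\{0,1\}^{E}$ be the set of feasible solutions of the symmetric traveling salesman problem, i.e. of all $x\in\{0,1\}^E$ with $\sum_{j\ne i}x_{ij}=2$ for every vertex $i$ and $\sum_{ij\in E,\ i,j\in A}x_{ij}\le |A|-1$ for every $\emptyset\subsetneq A\subsetneq\{1,\dots,n\}$. Let $Q_T^n=\operatorname{conv}\mathcal F_n\subseteq\mathbb R^E$ be the symmetric traveling salesman polytope, and let the TSP diameter polytope be $$P^n=\operatorname{conv}\{x\oplus y\oplus z:\ x,y\in\mathcal F_n,\ z\in\{0,1\}^E,\ x_{ij}+y_{ij}-z_{ij}\le 1\text{ for all }ij\in E\}\subseteq\mathbb R^{3\binom n2}.$$ An inequality $a^Tw\le a_0$ is said to define a facet of a polytope $P$ if it is valid for all $w\in P$ and the face $\{w\in P: a^Tw=a_0\}$ has dimension $\dim P-1$ (the dimension being that of the affine hull, with $\dim\emptyset=-1$). Then: (a) If $a^Tx\le a_0$ (with $a\in\mathbb R^E$, $a_0\in\mathbb R$) defines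 a facet of $Q_T^n$, then $\hat a^T(x\oplus y\oplus z)\le a_0$ defines a facet of $P^n$, both for $\hat a=a\oplus 0\oplus 0$ and for $\hat a=0\oplus a\oplus 0$. (b) For every edge $ij\in E$, the inequalities $z_{ij}\ge 0$ and $z_{ij}\le 1$ define facets of $P^n$. (c) For every edge $ij\in E$, the inequality $x_{ij}+y_{ij}-z_{ij}\le 1$ defines a facet of $P^n$. -/

import Mathlib

/-- The dimension of a set `P` (in the uses below: a polytope or one of its faces): the dimension
of its affine hull, with the convention that the empty set has dimension `-1`. -/
noncomputable def polyDim {ι : Type*} (P : Set (ι → ℝ)) : ℤ :=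
  open Classical in if P = ∅ then -1 else (Module.finrank ℝ (affineSpan ℝ P).direction : ℤ)

/-- `aᵀ x ≤ a₀` is a valid inequality of `P`. -/
def IsValidIneq {ι : Type*} [Fintype ι] (P : Set (ι → ℝ)) (a : ι → ℝ) (a₀ : ℝ) : Prop :=
  ∀ x ∈ P, a ⬝ᵥ x ≤ a₀

/-- The face of `P` defined by `aᵀ x ≤ a₀` (when that inequality is valid). -/
def faceOf {ι : Type*} [Fintype ι] (P : Set (ι → ℝ)) (a : ι → ℝ) (a₀ : ℝ) : Set (ι → ℝ) :=
  {x | x ∈ P ∧ a ⬝ᵥ x = a₀}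

/-- `aᵀ x ≤ a₀` defines a facet of `P`: it is valid for `P` and the face that it defines has
dimension `dim P - 1`. -/
def DefinesFacet {ι : Type*} [Fintype ι] (P : Set (ι → ℝ)) (a : ι → ℝ) (a₀ : ℝ) : Prop :=
  IsValidIneq P a a₀ ∧ polyDim (faceOf P a a₀) = polyDim P - 1

/-- The edges of the complete graph `K_n` on the vertex set `Fin n`. -/
abbrev KEdge (n : ℕ) : Type := (⊤ : SimpleGraph (Fin n)).edgeSet

/-- A vector all of whose entries are `0` or `1`. -/
def IsBinary {ι : Type*} (x : ι → ℝ) : Prop := ∀ i, x i = 0 ∨ x i = 1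

/-- The degree constraints `∑_{j ≠ i} x_{ij} = 2` at all vertices `i`. -/
def DegreeConstraints (n : ℕ) (x : KEdge n → ℝ) : Prop :=
  ∀ i : Fin n, ∑ e ∈ Finset.univ.filter (fun e : KEdge n => i ∈ e.1), x e = 2

/-- The subtour elimination constraints `x(E(K_n[A])) ≤ |A| - 1` for all nonempty proper subsets
`A` of the vertex set. (An edge lies in `A.sym2` iff both its endpoints lie in `A`.) -/
def SubtourConstraints (n : ℕ) (x : KEdge n → ℝ) : Prop :=
  ∀ A : Finset (Fin n), A.Nonempty → A ≠ Finset.univ →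
    ∑ e ∈ Finset.univ.filter (fun e : KEdge n => e.1 ∈ A.sym2), x e ≤ (A.card : ℝ) - 1

/-- The feasible solutions of the symmetric traveling salesman problem on `n` cities. -/
def tspFeasible (n : ℕ) : Set (KEdge n → ℝ) :=
  {x | IsBinary x ∧ DegreeConstraints n x ∧ SubtourConstraints n x}

/-- The symmetric traveling salesman polytope on `n` cities. -/
def tspPolytope (n : ℕ) : Set (KEdge n → ℝ) := convexHull ℝ (tspFeasible n)

/-- The concatenation `x ⊕ y ⊕ z`. -/
def concat₃ {ι : Type*} (x y z : ι → ℝ) : ι ⊕ ι ⊕ ι → ℝ := Sum.elim x (Sum.elim y z)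

/-- The feasible solutions `x ⊕ y ⊕ z` of the diameter binary program of the symmetric
traveling salesman problem: `x`, `y` are feasible for the latter, `z` is a 0/1 vector, and
`x_{ij} + y_{ij} - z_{ij} ≤ 1` for every edge `ij`. -/
def tspDiameterFeasible (n : ℕ) : Set (KEdge n ⊕ KEdge n ⊕ KEdge n → ℝ) :=
  {w | ∃ x y z : KEdge n → ℝ, w = concat₃ x y z ∧
    x ∈ tspFeasible n ∧ y ∈ tspFeasible n ∧ IsBinary z ∧ ∀ e, x e + y e - z e ≤ 1}

/-- The TSP diameter polytope. -/
def tspDiameterPolytope (n : ℕ) : Set (KEdge n ⊕ KEdge n ⊕ KEdge n → ℝ) :=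
  convexHull ℝ (tspDiameterFeasible n)

/-- The unit vector of the edge `e`. -/
def edgeUnit {n : ℕ} (e : KEdge n) : KEdge n → ℝ := Pi.single e 1

/-! ### Dimensions of faces -/

section Faces

/-! No dimension formula is needed. A valid inequality that is tight at one point of `P` and strict
at another defines a facet as soon as every direction of `P` orthogonal to `a` is a direction of the
face (`definesFacet_of_vectorSpan`).

Directions of the diameter polytope have their first two blocks in the direction space `V` of the
tour polytope. By `concat₃_mem_of_blocks` it is enough to exhibit three kinds of directions in the
face: vary `x` with `y` fixed, vary `y` with `x` fixed, and flip a single coordinate of `z`. A flip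
at `f` is free when one of the two tours avoids `f`, so the combinatorial input is just that every
edge is missed by some tour and used by another.

For `x_e + y_e - z_e ≤ 1`, tightness couples the blocks: `z_e` must follow `x_e` or `y_e`, which the
linear correction `g` records. For the other inequalities `g = 0`. The lifted inequalities inherit
the directions of their constrained block from the given facet. -/

theorem polyDim_of_nonempty {ι : Type*} {P : Set (ι → ℝ)} (hP : P.Nonempty) :
    polyDim P = (Module.finrank ℝ (vectorSpan ℝ P) : ℤ) := by
  rw [polyDim, if_neg hP.ne_empty, direction_affineSpan]

variable {ι : Type*} [Fintype ι]

theorem dotProduct_eq_zero_of_mem_vectorSpan_faceOf {P : Set (ι → ℝ)} {a : ι → ℝ} {a₀ : ℝ}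
    {u : ι → ℝ} (hu : u ∈ vectorSpan ℝ (faceOf P a a₀)) : a ⬝ᵥ u = 0 := by
  have h : vectorSpan ℝ (faceOf P a a₀) ≤ LinearMap.ker (dotProductBilin ℝ ℝ a) := by
    rw [vectorSpan_def, Submodule.span_le]
    rintro _ ⟨x, hx, y, hy, rfl⟩
    simp [dotProduct_sub, hx.2, hy.2]
  simpa using h hu

theorem vectorSpan_faceOf_le (P : Set (ι → ℝ)) (a : ι → ℝ) (a₀ : ℝ) :
    vectorSpan ℝ (faceOf P a a₀) ≤ vectorSpan ℝ P :=
  vectorSpan_mono ℝ fun _ h => h.1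

theorem finrank_inf_ker_add_one {E : Type*} [AddCommGroup E] [Module ℝ E]
    [FiniteDimensional ℝ E] (V : Submodule ℝ E) (f : E →ₗ[ℝ] ℝ) {v : E} (hv : v ∈ V)
    (hfv : f v ≠ 0) :
    Module.finrank ℝ (V ⊓ LinearMap.ker f : Submodule ℝ E) + 1 = Module.finrank ℝ V := by
  have hg : f.domRestrict V ≠ 0 := fun h => hfv (by simpa using LinearMap.congr_fun h ⟨v, hv⟩)
  have h1 := Module.Dual.finrank_ker_add_one_of_ne_zero hg
  have h2 : (V ⊓ LinearMap.ker f : Submodule ℝ E) =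
      (LinearMap.ker (f.domRestrict V)).map V.subtype := by
    ext x
    simp only [Submodule.mem_inf, LinearMap.mem_ker, Submodule.mem_map, Submodule.subtype_apply,
      Subtype.exists, LinearMap.domRestrict_apply]
    constructor
    · rintro ⟨h, h'⟩
      exact ⟨x, h, h', rfl⟩
    · rintro ⟨y, h, h', rfl⟩
      exact ⟨h, h'⟩
  rw [h2, Submodule.finrank_map_subtype_eq]
  exact h1

/-- The direction `q - p` is not orthogonal to `a`, so the hyperplane cuts the direction space
properly. -/
theorem finrank_vectorSpan_inf_ker {P : Set (ι → ℝ)} {a : ι → ℝ} {a₀ : ℝ} {p q : ι → ℝ}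
    (hp : p ∈ faceOf P a a₀) (hq : q ∈ P) (hqa : a ⬝ᵥ q ≠ a₀) :
    Module.finrank ℝ
      (vectorSpan ℝ P ⊓ LinearMap.ker (dotProductBilin ℝ ℝ a) : Submodule ℝ (ι → ℝ)) + 1 =
      Module.finrank ℝ (vectorSpan ℝ P) := by
  refine finrank_inf_ker_add_one _ _ (vsub_mem_vectorSpan ℝ hq hp.1) ?_
  simpa [dotProduct_sub, hp.2, sub_eq_zero] using hqa

theorem vectorSpan_faceOf_le_inf_ker (P : Set (ι → ℝ)) (a : ι → ℝ) (a₀ : ℝ) :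
    vectorSpan ℝ (faceOf P a a₀) ≤
      vectorSpan ℝ P ⊓ LinearMap.ker (dotProductBilin ℝ ℝ a) :=
  fun _ hu => ⟨vectorSpan_faceOf_le P a a₀ hu, by
    simpa using dotProduct_eq_zero_of_mem_vectorSpan_faceOf hu⟩

/-- A valid inequality which is tight somewhere, strict somewhere, and whose face contains all
directions of `P` orthogonal to it defines a facet. -/
theorem definesFacet_of_vectorSpan {P : Set (ι → ℝ)} {a : ι → ℝ} {a₀ : ℝ} {p q : ι → ℝ}
    (hvalid : IsValidIneq P a a₀) (hp : p ∈ faceOf P a a₀) (hq : q ∈ P) (hqa : a ⬝ᵥ q ≠ a₀)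
    (h : ∀ u ∈ vectorSpan ℝ P, a ⬝ᵥ u = 0 → u ∈ vectorSpan ℝ (faceOf P a a₀)) :
    DefinesFacet P a a₀ := by
  refine ⟨hvalid, ?_⟩
  have heq : vectorSpan ℝ (faceOf P a a₀) =
      vectorSpan ℝ P ⊓ LinearMap.ker (dotProductBilin ℝ ℝ a) :=
    le_antisymm (vectorSpan_faceOf_le_inf_ker P a a₀)
      fun u hu => h u hu.1 (by simpa using hu.2)
  have hrank := finrank_vectorSpan_inf_ker hp hq hqa
  rw [polyDim_of_nonempty ⟨p, hp⟩, polyDim_of_nonempty ⟨q, hq⟩, heq, ← hrank]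
  push_cast
  ring

/-- Since `∅` has dimension `-1`, an empty face can be a facet only of a single point. -/
theorem DefinesFacet.faceOf_nonempty {P : Set (ι → ℝ)} {a : ι → ℝ} {a₀ : ℝ}
    (h : DefinesFacet P a a₀) (hP : P.Nontrivial) : (faceOf P a a₀).Nonempty := by
  by_contra hne
  have h2 := h.2
  rw [Set.not_nonempty_iff_eq_empty] at hne
  rw [polyDim_of_nonempty hP.nonempty, hne, polyDim, if_pos rfl] at h2
  have h0 : Module.finrank ℝ (vectorSpan ℝ P) = 0 := by omega
  rw [Submodule.finrank_eq_zero, vectorSpan_eq_bot_iff_subsingleton] at h0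
  exact Set.not_subsingleton_iff.2 hP h0

theorem DefinesFacet.exists_dotProduct_ne {P : Set (ι → ℝ)} {a : ι → ℝ} {a₀ : ℝ}
    (h : DefinesFacet P a a₀) : ∃ q ∈ P, a ⬝ᵥ q ≠ a₀ := by
  by_contra! hall
  have heq : faceOf P a a₀ = P := Set.ext fun x => ⟨fun hx => hx.1, fun hx => ⟨hx, hall x hx⟩⟩
  have h2 := h.2
  rw [heq] at h2
  omega

/-- Converse of the facet criterion: the inclusion of direction spaces is an equality because the
dimensions agree. -/
theorem DefinesFacet.mem_vectorSpan_faceOf {P : Set (ι → ℝ)} {a : ι → ℝ} {a₀ : ℝ}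
    (h : DefinesFacet P a a₀) (hP : P.Nontrivial) {u : ι → ℝ} (hu : u ∈ vectorSpan ℝ P)
    (hau : a ⬝ᵥ u = 0) : u ∈ vectorSpan ℝ (faceOf P a a₀) := by
  obtain ⟨p, hp⟩ := h.faceOf_nonempty hP
  obtain ⟨q, hq, hqa⟩ := h.exists_dotProduct_ne
  have hrank := finrank_vectorSpan_inf_ker hp hq hqa
  have h2 := h.2
  rw [polyDim_of_nonempty ⟨p, hp⟩, polyDim_of_nonempty ⟨q, hq⟩] at h2
  rw [Submodule.eq_of_le_of_finrank_eq (vectorSpan_faceOf_le_inf_ker P a a₀) (by omega)]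
  exact ⟨hu, by simpa using hau⟩

theorem map_mem_of_mem_vectorSpan {E F : Type*} [AddCommGroup E] [Module ℝ E] [AddCommGroup F]
    [Module ℝ F] {S : Set E} (L : E →ₗ[ℝ] F) (W : Submodule ℝ F)
    (h : ∀ x ∈ S, ∀ y ∈ S, L x - L y ∈ W) {u : E} (hu : u ∈ vectorSpan ℝ S) : L u ∈ W := by
  have hle : vectorSpan ℝ S ≤ W.comap L := by
    rw [vectorSpan_def, Submodule.span_le]
    rintro _ ⟨x, hx, y, hy, rfl⟩
    simpa using h x hx y hy
  exact hle hu

end Faces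

/-! ### Concatenated vectors -/

section Concat

variable {ι : Type*}

theorem concat₃_add (x y z x' y' z' : ι → ℝ) :
    concat₃ x y z + concat₃ x' y' z' = concat₃ (x + x') (y + y') (z + z') := by
  ext (i | i | i) <;> rfl

theorem concat₃_sub (x y z x' y' z' : ι → ℝ) :
    concat₃ x y z - concat₃ x' y' z' = concat₃ (x - x') (y - y') (z - z') := by
  ext (i | i | i) <;> rfl

theorem smul_concat₃ (c : ℝ) (x y z : ι → ℝ) :
    c • concat₃ x y z = concat₃ (c • x) (c • y) (c • z) := by
  ext (i | i | i) <;> rfl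

theorem exists_eq_concat₃ (w : ι ⊕ ι ⊕ ι → ℝ) : ∃ x y z, w = concat₃ x y z :=
  ⟨fun i => w (.inl i), fun i => w (.inr (.inl i)), fun i => w (.inr (.inr i)), by
    ext (i | i | i) <;> rfl⟩

theorem concat₃_dotProduct_concat₃ [Fintype ι] (a b c x y z : ι → ℝ) :
    concat₃ a b c ⬝ᵥ concat₃ x y z = a ⬝ᵥ x + b ⬝ᵥ y + c ⬝ᵥ z := by
  simp [dotProduct, concat₃, Fintype.sum_sum_type, add_assoc]

/-- Concatenation as a linear map. -/
def concatLinear (ι : Type*) : (ι → ℝ) × (ι → ℝ) × (ι → ℝ) →ₗ[ℝ] (ι ⊕ ι ⊕ ι → ℝ) where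
  toFun p := concat₃ p.1 p.2.1 p.2.2
  map_add' _ _ := (concat₃_add _ _ _ _ _ _).symm
  map_smul' _ _ := (smul_concat₃ _ _ _ _).symm

/-- A coordinate block of a concatenated vector, as a linear map. -/
def blockLinear {κ : Type*} (f : ι → κ) : (κ → ℝ) →ₗ[ℝ] (ι → ℝ) := LinearMap.funLeft ℝ ℝ f

/-- Asking for unit vectors only on the support of `z` lets the facet proofs skip the coordinate `e`
fixed by tightness. -/
theorem concat₃_zero_zero_mem [Fintype ι] [DecidableEq ι] (W : Submodule ℝ (ι ⊕ ι ⊕ ι → ℝ))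
    (z : ι → ℝ) (h : ∀ i, z i ≠ 0 → concat₃ 0 0 (Pi.single i (1 : ℝ)) ∈ W) :
    concat₃ 0 0 z ∈ W := by
  have hz : concat₃ 0 0 z = ∑ i, z i • concat₃ 0 0 (Pi.single i (1 : ℝ)) := by
    have hs : ∑ i, z i • (concatLinear ι) (0, 0, Pi.single i (1 : ℝ)) =
        concatLinear ι (∑ i, z i • (0, 0, Pi.single i (1 : ℝ))) := by
      rw [map_sum]
      simp only [map_smul]
    refine Eq.trans ?_ hs.symm
    have : (∑ i, z i • ((0 : ι → ℝ), (0 : ι → ℝ), Pi.single i (1 : ℝ))) = (0, 0, z) := by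
      refine Prod.ext ?_ (Prod.ext ?_ ?_)
      · simp [Prod.fst_sum]
      · simp [Prod.fst_sum, Prod.snd_sum]
      · ext j
        simp [Prod.snd_sum, Finset.sum_apply, Pi.single_apply]
    rw [this]
    rfl
  rw [hz]
  refine W.sum_mem fun i _ => ?_
  by_cases hi : z i = 0
  · simp [hi]
  · exact W.smul_mem _ (h i hi)

end Concat

/-! ### Tours -/

section Tours

variable {n : ℕ}

/-- The `k`-th edge of the closed walk visiting `σ 0, σ 1, …, σ (n - 1)`. -/
def tourEdge [NeZero n] (hn : 3 ≤ n) (σ : Equiv.Perm (Fin n)) (k : Fin n) : KEdge n :=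
  ⟨s(σ k, σ (k + 1)), by
    have h1 : (1 : Fin n) ≠ 0 := by
      rw [Ne, Fin.ext_iff, Fin.val_one', Fin.val_zero, Nat.mod_eq_of_lt (by omega)]
      omega
    simp [h1]⟩

/-- The incidence vector of the tour visiting `σ 0, σ 1, …, σ (n - 1)`. -/
noncomputable def tourVec [NeZero n] (hn : 3 ≤ n) (σ : Equiv.Perm (Fin n)) : KEdge n → ℝ :=
  open Classical in fun e => if e ∈ Set.range (tourEdge hn σ) then 1 else 0

theorem Fin.one_add_one_ne_zero_of_three_le [NeZero n] (hn : 3 ≤ n) : (1 + 1 : Fin n) ≠ 0 := by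
  rw [Ne, Fin.ext_iff, Fin.val_add, Fin.val_one', Fin.val_zero, Nat.mod_eq_of_lt (a := 1) (by omega),
    Nat.mod_eq_of_lt (by omega)]
  omega

/-- Two positions giving the same edge in reverse would force `1 + 1 = 0` in `Fin n`. -/
theorem tourEdge_injective [NeZero n] (hn : 3 ≤ n) (σ : Equiv.Perm (Fin n)) :
    Function.Injective (tourEdge hn σ) := by
  intro k l h
  have h' : s(σ k, σ (k + 1)) = s(σ l, σ (l + 1)) := congrArg Subtype.val h
  rw [Sym2.eq_iff] at h'
  rcases h' with ⟨h, -⟩ | ⟨h, h'⟩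
  · exact σ.injective h
  · have h1 := σ.injective h
    have h2 := σ.injective h'
    rw [h1, add_assoc] at h2
    exact absurd (add_eq_left.1 h2) (Fin.one_add_one_ne_zero_of_three_le hn)

theorem sum_tourVec [NeZero n] (hn : 3 ≤ n) (σ : Equiv.Perm (Fin n)) (p : KEdge n → Prop)
    [DecidablePred p] :
    ∑ e ∈ Finset.univ.filter p, tourVec hn σ e =
      ((Finset.univ.filter fun k => p (tourEdge hn σ k)).card : ℝ) := by
  classical
  rw [← Finset.card_map ⟨_, tourEdge_injective hn σ⟩]
  simp only [tourVec, Finset.sum_ite, Finset.sum_const_zero, add_zero, Finset.sum_const,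
    nsmul_eq_mul, mul_one, Finset.filter_filter]
  congr 2
  ext e
  simp only [Finset.mem_filter, Finset.mem_univ, true_and, Finset.mem_map, Set.mem_range,
    Function.Embedding.coeFn_mk]
  constructor
  · rintro ⟨h, k, rfl⟩
    exact ⟨k, h, rfl⟩
  · rintro ⟨k, h, rfl⟩
    exact ⟨h, k, rfl⟩

theorem tourVec_mem_tspFeasible [NeZero n] (hn : 3 ≤ n) (σ : Equiv.Perm (Fin n)) :
    tourVec hn σ ∈ tspFeasible n := by
  classical
  refine ⟨fun e => ?_, fun i => ?_, fun A hA hA' => ?_⟩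
  · unfold tourVec
    split_ifs
    · exact Or.inr rfl
    · exact Or.inl rfl
  · rw [sum_tourVec hn σ fun e : KEdge n => i ∈ e.1]
    have h1 : (1 : Fin n) ≠ 0 := fun h =>
      Fin.one_add_one_ne_zero_of_three_le hn (by rw [h, add_zero])
    -- The tour meets `i` in the edge leaving its position and the edge arriving there, indices
    -- being cyclic.
    have hset : (Finset.univ.filter fun k => i ∈ (tourEdge hn σ k).1) =
        {σ.symm i, σ.symm i - 1} := by
      ext k
      simp only [tourEdge, Sym2.mem_iff, Finset.mem_filter, Finset.mem_univ, true_and,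
        Finset.mem_insert, Finset.mem_singleton]
      rw [← Equiv.symm_apply_eq σ, ← Equiv.symm_apply_eq σ, eq_sub_iff_add_eq, eq_comm (a := k),
        eq_comm (a := k + 1)]
    rw [hset, Finset.card_pair]
    · norm_num
    · intro h
      exact h1 (sub_eq_self.1 h.symm)
  · rw [sum_tourVec hn σ fun e : KEdge n => e.1 ∈ A.sym2]
    have hcard : (Finset.univ.filter fun k => σ k ∈ A).card = A.card := by
      rw [← Finset.card_map σ.toEmbedding]
      congr 1
      ext i
      simp only [Finset.mem_map_equiv, Finset.mem_filter, Finset.mem_univ, true_and,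
        Equiv.apply_symm_apply]
    -- Each edge inside `A` is charged to its starting vertex. Equality would make `A` closed under
    -- the successor along the tour, hence everything.
    have hlt : (Finset.univ.filter fun k => (tourEdge hn σ k).1 ∈ A.sym2).card < A.card := by
      rw [← hcard]
      refine Finset.card_lt_card (Finset.ssubset_iff_subset_ne.2 ⟨fun k hk => ?_, fun heq => ?_⟩)
      · simp only [tourEdge, Finset.mk_mem_sym2_iff, Finset.mem_filter, Finset.mem_univ,
          true_and] at hk ⊢
        exact hk.1
      · have hstep : ∀ k, σ k ∈ A → σ (k + 1) ∈ A := fun k hk => by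
          have : k ∈ Finset.univ.filter fun k => (tourEdge hn σ k).1 ∈ A.sym2 := by
            rw [heq]
            simpa using hk
          simp only [tourEdge, Finset.mk_mem_sym2_iff, Finset.mem_filter, Finset.mem_univ,
            true_and] at this
          exact this.2
        obtain ⟨i, hi⟩ := hA
        have hall : ∀ m : ℕ, σ (σ.symm i + Fin.ofNat n m) ∈ A := by
          intro m
          induction m with
          | zero => simpa using hi
          | succ m ih =>
            have hm : Fin.ofNat n (m + 1) = Fin.ofNat n m + 1 := by
              ext
              simp [Fin.val_add]
            rw [hm, ← add_assoc]
            exact hstep _ ih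
        refine hA' (Finset.eq_univ_iff_forall.2 fun j => ?_)
        have := hall (σ.symm j - σ.symm i).val
        rwa [Fin.ofNat_val_eq_self, add_sub_cancel, Equiv.apply_symm_apply] at this
    have : (Finset.univ.filter fun k => (tourEdge hn σ k).1 ∈ A.sym2).card + 1 ≤ A.card := hlt
    rw [le_sub_iff_add_le]
    exact_mod_cast this

theorem exists_perm_map_pair {α : Type*} [DecidableEq α] {a b u v : α} (hab : a ≠ b)
    (huv : u ≠ v) : ∃ σ : Equiv.Perm α, σ a = u ∧ σ b = v := by
  refine ⟨(Equiv.swap a u).trans (Equiv.swap (Equiv.swap a u b) v), ?_, ?_⟩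
  · rw [Equiv.trans_apply, Equiv.swap_apply_left, Equiv.swap_apply_of_ne_of_ne _ huv]
    intro h
    apply hab
    apply (Equiv.swap a u).injective
    rw [Equiv.swap_apply_left]
    exact h
  · rw [Equiv.trans_apply, Equiv.swap_apply_left]

theorem exists_tour_mem (hn : 3 ≤ n) (e : KEdge n) : ∃ x ∈ tspFeasible n, x e = 1 := by
  have : NeZero n := ⟨by omega⟩
  obtain ⟨e, he⟩ := e
  induction e using Sym2.ind with
  | _ u v =>
    have h1 : (0 : Fin n) ≠ 0 + 1 := fun h =>
      Fin.one_add_one_ne_zero_of_three_le hn (by rw [zero_add] at h; rw [← h, add_zero])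
    obtain ⟨σ, h0, h1⟩ := exists_perm_map_pair h1 (u := u) (v := v) (by simpa using he)
    refine ⟨tourVec hn σ, tourVec_mem_tspFeasible hn σ, if_pos ⟨0, Subtype.ext ?_⟩⟩
    simp only [tourEdge, h0, h1]

/-- The endpoints are placed at positions `0` and `2`, which are not cyclically adjacent once `n ≥
4`. -/
theorem exists_tour_notMem (hn : 4 ≤ n) (e : KEdge n) : ∃ x ∈ tspFeasible n, x e = 0 := by
  have : NeZero n := ⟨by omega⟩
  have hn3 : 3 ≤ n := by omega
  obtain ⟨e, he⟩ := e
  induction e using Sym2.ind with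
  | _ u v =>
    have h2 : (0 : Fin n) ≠ 1 + 1 := (Fin.one_add_one_ne_zero_of_three_le hn3).symm
    obtain ⟨σ, h0, h2'⟩ := exists_perm_map_pair h2 (u := u) (v := v) (by simpa using he)
    refine ⟨tourVec hn3 σ, tourVec_mem_tspFeasible hn3 σ, if_neg ?_⟩
    rintro ⟨k, hk⟩
    have hk' : s(σ k, σ (k + 1)) = s(u, v) := congrArg Subtype.val hk
    rw [← h0, ← h2', Sym2.eq_iff] at hk'
    simp only [σ.injective.eq_iff] at hk'
    rcases hk' with ⟨rfl, h⟩ | ⟨rfl, h⟩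
    · simp only [zero_add, left_eq_add] at h
      exact Fin.one_add_one_ne_zero_of_three_le hn3 (by rw [h, add_zero])
    · have := congrArg Fin.val h
      simp only [Fin.val_add, Fin.val_one', Fin.val_zero, Nat.mod_eq_of_lt (show 1 < n by omega),
        Nat.mod_eq_of_lt (show 1 + 1 < n by omega), Nat.mod_eq_of_lt (show 1 + 1 + 1 < n by omega)]
        at this
      omega

theorem nontrivial_tspFeasible (hn : 4 ≤ n) : (tspFeasible n).Nontrivial := by
  have e : KEdge n := ⟨s(⟨0, by omega⟩, ⟨1, by omega⟩), by simp⟩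
  obtain ⟨x, hx, hxe⟩ := exists_tour_mem (by omega) e
  obtain ⟨y, hy, hye⟩ := exists_tour_notMem hn e
  refine ⟨x, hx, y, hy, fun h => ?_⟩
  rw [h, hye] at hxe
  exact zero_ne_one hxe

end Tours

/-! ### The diameter polytope -/

section Diameter

theorem concat₃_sub_mem_vectorSpan {ι : Type*} {S : Set (ι ⊕ ι ⊕ ι → ℝ)} {x y z x' y' z' : ι → ℝ}
    (h : concat₃ x y z ∈ S) (h' : concat₃ x' y' z' ∈ S) :
    concat₃ (x - x') (y - y') (z - z') ∈ vectorSpan ℝ S := by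
  rw [← concat₃_sub]
  exact vsub_mem_vectorSpan ℝ h h'

/-- A submodule contains `u₁ ⊕ u₂ ⊕ u₃` if it contains enough directions of each block, where the
directions of the first two blocks may be corrected by a linear map `g` in the third block. -/
theorem concat₃_mem_of_blocks {ι : Type*} [Fintype ι] [DecidableEq ι] {S₁ S₂ : Set (ι → ℝ)}
    {W : Submodule ℝ (ι ⊕ ι ⊕ ι → ℝ)} (g : (ι → ℝ) →ₗ[ℝ] (ι → ℝ))
    (hx : ∀ x ∈ S₁, ∀ x' ∈ S₁, concat₃ (x - x') 0 (g x - g x') ∈ W)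
    (hy : ∀ y ∈ S₂, ∀ y' ∈ S₂, concat₃ 0 (y - y') (g y - g y') ∈ W)
    {u₁ u₂ u₃ : ι → ℝ} (h₁ : u₁ ∈ vectorSpan ℝ S₁) (h₂ : u₂ ∈ vectorSpan ℝ S₂)
    (hz : ∀ i, (u₃ - g u₁ - g u₂) i ≠ 0 → concat₃ 0 0 (Pi.single i (1 : ℝ)) ∈ W) :
    concat₃ u₁ u₂ u₃ ∈ W := by
  have e₁ : concat₃ u₁ 0 (g u₁) ∈ W := by
    refine map_mem_of_mem_vectorSpan
      ((concatLinear ι).comp (LinearMap.id.prod ((0 : (ι → ℝ) →ₗ[ℝ] (ι → ℝ)).prod g))) W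
      (fun x hx' y hy' => ?_) h₁
    have := hx x hx' y hy'
    rw [← sub_self (0 : ι → ℝ), ← concat₃_sub] at this
    exact this
  have e₂ : concat₃ 0 u₂ (g u₂) ∈ W := by
    refine map_mem_of_mem_vectorSpan
      ((concatLinear ι).comp ((0 : (ι → ℝ) →ₗ[ℝ] (ι → ℝ)).prod (LinearMap.id.prod g))) W
      (fun x hx' y hy' => ?_) h₂
    have := hy x hx' y hy'
    rw [← sub_self (0 : ι → ℝ), ← concat₃_sub] at this
    exact this
  -- What remains after the two corrected blocks lives in the third block only.
  have := W.add_mem (W.add_mem e₁ e₂) (concat₃_zero_zero_mem W _ hz)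
  rw [concat₃_add, concat₃_add] at this
  convert this using 2 <;> abel

theorem isValidIneq_convexHull {ι : Type*} [Fintype ι] {S : Set (ι → ℝ)} {a : ι → ℝ} {a₀ : ℝ}
    (h : ∀ x ∈ S, a ⬝ᵥ x ≤ a₀) : IsValidIneq (convexHull ℝ S) a a₀ :=
  fun _ hx => convexHull_min (t := {x | a ⬝ᵥ x ≤ a₀}) h
    (convex_halfSpace_le (dotProductBilin ℝ ℝ a).isLinear a₀) hx

theorem vectorSpan_convexHull {E : Type*} [AddCommGroup E] [Module ℝ E] (S : Set E) :
    vectorSpan ℝ (convexHull ℝ S) = vectorSpan ℝ S := by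
  rw [← direction_affineSpan, affineSpan_convexHull, direction_affineSpan]

theorem convex_setOf_concat₃_left {ι : Type*} {P : Set (ι ⊕ ι ⊕ ι → ℝ)} (hP : Convex ℝ P)
    (y z : ι → ℝ) : Convex ℝ {x | concat₃ x y z ∈ P} := by
  intro x hx x' hx' s t hs ht hst
  have := hP hx hx' hs ht hst
  rwa [smul_concat₃, smul_concat₃, concat₃_add, ← add_smul, ← add_smul, hst, one_smul,
    one_smul] at this

theorem convex_setOf_concat₃_middle {ι : Type*} {P : Set (ι ⊕ ι ⊕ ι → ℝ)} (hP : Convex ℝ P)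
    (x z : ι → ℝ) : Convex ℝ {y | concat₃ x y z ∈ P} := by
  intro y hy y' hy' s t hs ht hst
  have := hP hy hy' hs ht hst
  rwa [smul_concat₃, smul_concat₃, concat₃_add, ← add_smul, ← add_smul, hst, one_smul,
    one_smul] at this

variable {n : ℕ}

theorem concat₃_mem_tspDiameterPolytope {x y z : KEdge n → ℝ} (hx : x ∈ tspFeasible n)
    (hy : y ∈ tspFeasible n) (hz : IsBinary z) (h : ∀ e, x e + y e - z e ≤ 1) :
    concat₃ x y z ∈ tspDiameterPolytope n :=
  subset_convexHull ℝ _ ⟨x, y, z, rfl, hx, hy, hz, h⟩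

theorem tspFeasible.le_one {x : KEdge n → ℝ} (hx : x ∈ tspFeasible n) (e : KEdge n) :
    x e ≤ 1 := by
  rcases hx.1 e with h | h <;> simp [h]

theorem tspFeasible.nonneg {x : KEdge n → ℝ} (hx : x ∈ tspFeasible n) (e : KEdge n) :
    0 ≤ x e := by
  rcases hx.1 e with h | h <;> simp [h]

/-- When `y ≤ z` the linking constraints follow from `x ≤ 1`, so `x` may be any tour, and then by
convexity any point of the tour polytope. -/
theorem concat₃_mem_of_mem_left {x y z : KEdge n → ℝ} (hx : x ∈ tspPolytope n)
    (hy : y ∈ tspFeasible n) (hz : IsBinary z) (h : ∀ e, y e ≤ z e) :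
    concat₃ x y z ∈ tspDiameterPolytope n :=
  convexHull_min (t := {x | concat₃ x y z ∈ tspDiameterPolytope n})
    (fun x' hx' => concat₃_mem_tspDiameterPolytope hx' hy hz fun e => by
      linarith [h e, tspFeasible.le_one hx' e])
    (convex_setOf_concat₃_left (convex_convexHull ℝ _) y z) hx

theorem concat₃_mem_of_mem_middle {x y z : KEdge n → ℝ} (hx : x ∈ tspFeasible n)
    (hy : y ∈ tspPolytope n) (hz : IsBinary z) (h : ∀ e, x e ≤ z e) :
    concat₃ x y z ∈ tspDiameterPolytope n :=
  convexHull_min (t := {y | concat₃ x y z ∈ tspDiameterPolytope n})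
    (fun y' hy' => concat₃_mem_tspDiameterPolytope hx hy' hz fun e => by
      linarith [h e, tspFeasible.le_one hy' e])
    (convex_setOf_concat₃_middle (convex_convexHull ℝ _) x z) hy

theorem blocks_mem_tspPolytope {x y z : KEdge n → ℝ}
    (h : concat₃ x y z ∈ tspDiameterPolytope n) : x ∈ tspPolytope n ∧ y ∈ tspPolytope n := by
  constructor
  · refine convexHull_min (t := blockLinear Sum.inl ⁻¹' tspPolytope n) ?_
      ((convex_convexHull ℝ _).linear_preimage _) h
    rintro _ ⟨x, y, z, rfl, hx, -⟩
    exact subset_convexHull ℝ _ hx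
  · refine convexHull_min (t := blockLinear (Sum.inr ∘ Sum.inl) ⁻¹' tspPolytope n) ?_
      ((convex_convexHull ℝ _).linear_preimage _) h
    rintro _ ⟨x, y, z, rfl, -, hy, -⟩
    exact subset_convexHull ℝ _ hy

theorem blocks_mem_vectorSpan {x y z : KEdge n → ℝ}
    (h : concat₃ x y z ∈ vectorSpan ℝ (tspDiameterPolytope n)) :
    x ∈ vectorSpan ℝ (tspPolytope n) ∧ y ∈ vectorSpan ℝ (tspPolytope n) := by
  constructor
  · refine map_mem_of_mem_vectorSpan (blockLinear Sum.inl) _ (fun w hw w' hw' => ?_) h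
    obtain ⟨x, y, z, rfl⟩ := exists_eq_concat₃ w
    obtain ⟨x', y', z', rfl⟩ := exists_eq_concat₃ w'
    exact vsub_mem_vectorSpan ℝ (blocks_mem_tspPolytope hw).1 (blocks_mem_tspPolytope hw').1
  · refine map_mem_of_mem_vectorSpan (blockLinear (Sum.inr ∘ Sum.inl)) _
      (fun w hw w' hw' => ?_) h
    obtain ⟨x, y, z, rfl⟩ := exists_eq_concat₃ w
    obtain ⟨x', y', z', rfl⟩ := exists_eq_concat₃ w'
    exact vsub_mem_vectorSpan ℝ (blocks_mem_tspPolytope hw).2 (blocks_mem_tspPolytope hw').2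

theorem isBinary_one {ι : Type*} : IsBinary (1 : ι → ℝ) := fun _ => Or.inr rfl

theorem isBinary_one_sub_edgeUnit (e : KEdge n) : IsBinary (1 - edgeUnit e) := by
  intro f
  by_cases h : f = e
  · subst h
    simp [edgeUnit]
  · simp [edgeUnit, h]

theorem le_one_sub_edgeUnit {x : KEdge n → ℝ} (hx : x ∈ tspFeasible n) {e : KEdge n}
    (he : x e = 0) (f : KEdge n) : x f ≤ (1 - edgeUnit e : KEdge n → ℝ) f := by
  by_cases h : f = e
  · subst h
    simp [edgeUnit, he]
  · simpa [edgeUnit, h] using tspFeasible.le_one hx f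

@[simp]
theorem edgeUnit_dotProduct (e : KEdge n) (x : KEdge n → ℝ) : edgeUnit e ⬝ᵥ x = x e := by
  simp [edgeUnit]

/-! ### Facets lifted from the tour polytope -/

theorem definesFacet_lift_left (hn : 4 ≤ n) {a : KEdge n → ℝ} {a₀ : ℝ}
    (h : DefinesFacet (tspPolytope n) a a₀) :
    DefinesFacet (tspDiameterPolytope n) (concat₃ a 0 0) a₀ := by
  have hnt : (tspPolytope n).Nontrivial := (nontrivial_tspFeasible hn).mono (subset_convexHull ℝ _)
  obtain ⟨p, hp⟩ := h.faceOf_nonempty hnt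
  obtain ⟨q, hq, hqa⟩ := h.exists_dotProduct_ne
  obtain ⟨r, hr⟩ := (nontrivial_tspFeasible hn).nonempty
  have hface : ∀ {x y z}, x ∈ faceOf (tspPolytope n) a a₀ → y ∈ tspFeasible n → IsBinary z →
      (∀ e, y e ≤ z e) → concat₃ x y z ∈ faceOf (tspDiameterPolytope n) (concat₃ a 0 0) a₀ :=
    fun hx hy hz hyz => ⟨concat₃_mem_of_mem_left hx.1 hy hz hyz, by
      simpa [concat₃_dotProduct_concat₃] using hx.2⟩
  refine definesFacet_of_vectorSpan (fun w hw => ?_)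
    (hface hp hr isBinary_one (tspFeasible.le_one hr))
    (concat₃_mem_of_mem_left hq hr isBinary_one (tspFeasible.le_one hr))
    (by simpa [concat₃_dotProduct_concat₃] using hqa) (fun u hu hau => ?_)
  · obtain ⟨x, y, z, rfl⟩ := exists_eq_concat₃ w
    simpa [concat₃_dotProduct_concat₃] using h.1 x (blocks_mem_tspPolytope hw).1
  · obtain ⟨u₁, u₂, u₃, rfl⟩ := exists_eq_concat₃ u
    obtain ⟨h₁, h₂⟩ := blocks_mem_vectorSpan hu
    rw [tspPolytope, vectorSpan_convexHull] at h₂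
    refine concat₃_mem_of_blocks 0 (fun x hx x' hx' => ?_) (fun y hy y' hy' => ?_)
      (h.mem_vectorSpan_faceOf hnt h₁ (by simpa [concat₃_dotProduct_concat₃] using hau)) h₂
      (fun e _ => ?_)
    · simpa using concat₃_sub_mem_vectorSpan (hface hx hr isBinary_one (tspFeasible.le_one hr))
        (hface hx' hr isBinary_one (tspFeasible.le_one hr))
    · simpa using concat₃_sub_mem_vectorSpan (hface hp hy isBinary_one (tspFeasible.le_one hy))
        (hface hp hy' isBinary_one (tspFeasible.le_one hy'))
    -- With `y` avoiding `e`, both `z = 1` and `z = 1 - edgeUnit e` dominate `y`; they differ by the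
    -- required flip.
    · obtain ⟨y, hy, hye⟩ := exists_tour_notMem hn e
      simpa [edgeUnit] using
        concat₃_sub_mem_vectorSpan (hface hp hy isBinary_one (tspFeasible.le_one hy))
          (hface hp hy (isBinary_one_sub_edgeUnit e) (le_one_sub_edgeUnit hy hye))

theorem definesFacet_lift_middle (hn : 4 ≤ n) {a : KEdge n → ℝ} {a₀ : ℝ}
    (h : DefinesFacet (tspPolytope n) a a₀) :
    DefinesFacet (tspDiameterPolytope n) (concat₃ 0 a 0) a₀ := by
  have hnt : (tspPolytope n).Nontrivial := (nontrivial_tspFeasible hn).mono (subset_convexHull ℝ _)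
  obtain ⟨p, hp⟩ := h.faceOf_nonempty hnt
  obtain ⟨q, hq, hqa⟩ := h.exists_dotProduct_ne
  obtain ⟨r, hr⟩ := (nontrivial_tspFeasible hn).nonempty
  have hface : ∀ {x y z}, x ∈ tspFeasible n → y ∈ faceOf (tspPolytope n) a a₀ → IsBinary z →
      (∀ e, x e ≤ z e) → concat₃ x y z ∈ faceOf (tspDiameterPolytope n) (concat₃ 0 a 0) a₀ :=
    fun hx hy hz hxz => ⟨concat₃_mem_of_mem_middle hx hy.1 hz hxz, by
      simpa [concat₃_dotProduct_concat₃] using hy.2⟩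
  refine definesFacet_of_vectorSpan (fun w hw => ?_)
    (hface hr hp isBinary_one (tspFeasible.le_one hr))
    (concat₃_mem_of_mem_middle hr hq isBinary_one (tspFeasible.le_one hr))
    (by simpa [concat₃_dotProduct_concat₃] using hqa) (fun u hu hau => ?_)
  · obtain ⟨x, y, z, rfl⟩ := exists_eq_concat₃ w
    simpa [concat₃_dotProduct_concat₃] using h.1 y (blocks_mem_tspPolytope hw).2
  · obtain ⟨u₁, u₂, u₃, rfl⟩ := exists_eq_concat₃ u
    obtain ⟨h₁, h₂⟩ := blocks_mem_vectorSpan hu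
    rw [tspPolytope, vectorSpan_convexHull] at h₁
    refine concat₃_mem_of_blocks 0 (fun x hx x' hx' => ?_) (fun y hy y' hy' => ?_) h₁
      (h.mem_vectorSpan_faceOf hnt h₂ (by simpa [concat₃_dotProduct_concat₃] using hau))
      (fun e _ => ?_)
    · simpa using concat₃_sub_mem_vectorSpan (hface hx hp isBinary_one (tspFeasible.le_one hx))
        (hface hx' hp isBinary_one (tspFeasible.le_one hx'))
    · simpa using concat₃_sub_mem_vectorSpan (hface hr hy isBinary_one (tspFeasible.le_one hr))
        (hface hr hy' isBinary_one (tspFeasible.le_one hr))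
    · obtain ⟨x, hx, hxe⟩ := exists_tour_notMem hn e
      simpa [edgeUnit] using
        concat₃_sub_mem_vectorSpan (hface hx hp isBinary_one (tspFeasible.le_one hx))
          (hface hx hp (isBinary_one_sub_edgeUnit e) (le_one_sub_edgeUnit hx hxe))

/-! ### Facets involving `z` -/

theorem concat₃_mem_of_tight {a b c x y z : KEdge n → ℝ} {a₀ : ℝ} (hx : x ∈ tspFeasible n)
    (hy : y ∈ tspFeasible n) (hz : IsBinary z) (h : ∀ e, x e + y e - z e ≤ 1)
    (ha : a ⬝ᵥ x + b ⬝ᵥ y + c ⬝ᵥ z = a₀) :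
    concat₃ x y z ∈ faceOf (tspDiameterPolytope n) (concat₃ a b c) a₀ :=
  ⟨concat₃_mem_tspDiameterPolytope hx hy hz h, by rw [concat₃_dotProduct_concat₃, ha]⟩

theorem add_sub_le_one {x y z : KEdge n → ℝ} (hx : x ∈ tspFeasible n) (hy : y ∈ tspFeasible n)
    (hz : IsBinary z) (h : ∀ e, z e = 0 → x e = 0 ∨ y e = 0) (e : KEdge n) :
    x e + y e - z e ≤ 1 := by
  have h1 := tspFeasible.le_one hx e
  have h2 := tspFeasible.le_one hy e
  rcases hz e with hz | hz
  · rcases h e hz with h | h <;> linarith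
  · linarith

theorem definesFacet_le_one (hn : 4 ≤ n) (e : KEdge n) :
    DefinesFacet (tspDiameterPolytope n) (concat₃ 0 0 (edgeUnit e)) 1 := by
  obtain ⟨r, hr, hre⟩ := exists_tour_notMem hn e
  have hface : ∀ {x y z}, x ∈ tspFeasible n → y ∈ tspFeasible n → IsBinary z → z e = 1 →
      (∀ f, z f = 0 → x f = 0 ∨ y f = 0) →
      concat₃ x y z ∈ faceOf (tspDiameterPolytope n) (concat₃ 0 0 (edgeUnit e)) 1 :=
    fun hx hy hz hze h => concat₃_mem_of_tight hx hy hz (add_sub_le_one hx hy hz h) (by simpa)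
  have hone : ∀ {x y}, x ∈ tspFeasible n → y ∈ tspFeasible n →
      concat₃ x y 1 ∈ faceOf (tspDiameterPolytope n) (concat₃ 0 0 (edgeUnit e)) 1 :=
    fun hx hy => hface hx hy isBinary_one rfl (by simp)
  refine definesFacet_of_vectorSpan (isValidIneq_convexHull ?_) (hone hr hr)
    (concat₃_mem_of_mem_left (subset_convexHull ℝ _ hr) hr (isBinary_one_sub_edgeUnit e)
      (le_one_sub_edgeUnit hr hre))
    (by simp [concat₃_dotProduct_concat₃, edgeUnit]) (fun u hu hau => ?_)
  · rintro _ ⟨x, y, z, rfl, -, -, hz, -⟩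
    rcases hz e with h | h <;> simp [concat₃_dotProduct_concat₃, h]
  · obtain ⟨u₁, u₂, u₃, rfl⟩ := exists_eq_concat₃ u
    obtain ⟨h₁, h₂⟩ := blocks_mem_vectorSpan hu
    rw [tspPolytope, vectorSpan_convexHull] at h₁ h₂
    have hue : u₃ e = 0 := by simpa [concat₃_dotProduct_concat₃] using hau
    refine concat₃_mem_of_blocks 0 (fun x hx x' hx' => ?_) (fun y hy y' hy' => ?_) h₁ h₂
      (fun f hf => ?_)
    · simpa using concat₃_sub_mem_vectorSpan (hone hx hr) (hone hx' hr)
    · simpa using concat₃_sub_mem_vectorSpan (hone hr hy) (hone hr hy')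
    · have hfe : e ≠ f := by
        rintro rfl
        simp [hue] at hf
      obtain ⟨x, hx, hxf⟩ := exists_tour_notMem hn f
      simpa [edgeUnit] using concat₃_sub_mem_vectorSpan (hone hx hx)
        (hface hx hx (isBinary_one_sub_edgeUnit f) (by simp [edgeUnit, hfe]) fun f' hf' => by
          have := le_one_sub_edgeUnit hx hxf f'
          exact Or.inl (le_antisymm (this.trans hf'.le) (tspFeasible.nonneg hx f')))

/-- On this face `z e = 0`, so the two tours may not share `e`. Keeping one of them equal to `r`,
which avoids `e`, leaves the other unrestricted. -/
theorem definesFacet_nonneg (hn : 4 ≤ n) (e : KEdge n) :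
    DefinesFacet (tspDiameterPolytope n) (concat₃ 0 0 (-edgeUnit e)) 0 := by
  obtain ⟨r, hr, hre⟩ := exists_tour_notMem hn e
  have hface : ∀ {x y z}, x ∈ tspFeasible n → y ∈ tspFeasible n → IsBinary z → z e = 0 →
      (∀ f, z f = 0 → x f = 0 ∨ y f = 0) →
      concat₃ x y z ∈ faceOf (tspDiameterPolytope n) (concat₃ 0 0 (-edgeUnit e)) 0 :=
    fun hx hy hz hze h => concat₃_mem_of_tight hx hy hz (add_sub_le_one hx hy hz h) (by simpa)
  have hone : ∀ {x y}, x ∈ tspFeasible n → y ∈ tspFeasible n → x e = 0 ∨ y e = 0 →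
      concat₃ x y (1 - edgeUnit e) ∈
        faceOf (tspDiameterPolytope n) (concat₃ 0 0 (-edgeUnit e)) 0 :=
    fun hx hy h => hface hx hy (isBinary_one_sub_edgeUnit e) (by simp [edgeUnit]) fun f hf => by
      by_cases hfe : f = e
      · rwa [hfe]
      · simp [edgeUnit, hfe] at hf
  refine definesFacet_of_vectorSpan (isValidIneq_convexHull ?_) (hone hr hr (.inl hre))
    (concat₃_mem_of_mem_left (subset_convexHull ℝ _ hr) hr isBinary_one (tspFeasible.le_one hr))
    (by simp [concat₃_dotProduct_concat₃]) (fun u hu hau => ?_)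
  · rintro _ ⟨x, y, z, rfl, -, -, hz, -⟩
    rcases hz e with h | h <;> simp [concat₃_dotProduct_concat₃, h]
  · obtain ⟨u₁, u₂, u₃, rfl⟩ := exists_eq_concat₃ u
    obtain ⟨h₁, h₂⟩ := blocks_mem_vectorSpan hu
    rw [tspPolytope, vectorSpan_convexHull] at h₁ h₂
    have hue : u₃ e = 0 := by simpa [concat₃_dotProduct_concat₃] using hau
    refine concat₃_mem_of_blocks 0 (fun x hx x' hx' => ?_) (fun y hy y' hy' => ?_) h₁ h₂
      (fun f hf => ?_)
    · simpa using concat₃_sub_mem_vectorSpan (hone hx hr (.inr hre)) (hone hx' hr (.inr hre))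
    · simpa using concat₃_sub_mem_vectorSpan (hone hr hy (.inl hre)) (hone hr hy' (.inl hre))
    · have hfe : f ≠ e := by
        rintro rfl
        simp [hue] at hf
      obtain ⟨x, hx, hxf⟩ := exists_tour_notMem hn f
      -- Here `z` vanishes at both `e` and `f`: the first tour `r` avoids `e` and the second avoids
      -- `f`.
      have hbin : IsBinary (1 - edgeUnit e - edgeUnit f) := by
        intro g
        by_cases hge : g = e
        · simp [edgeUnit, hge, hfe.symm]
        · by_cases hgf : g = f <;> simp [edgeUnit, hge, hgf, hfe]
      simpa [edgeUnit] using concat₃_sub_mem_vectorSpan (hone hr hx (.inl hre))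
        (hface hr hx hbin (by simp [edgeUnit, hfe.symm]) fun g hg => by
          by_cases hge : g = e
          · exact Or.inl (hge ▸ hre)
          · by_cases hgf : g = f
            · exact Or.inr (hgf ▸ hxf)
            · simp [edgeUnit, hge, hgf] at hg)

theorem definesFacet_add_sub_le_one (hn : 4 ≤ n) (e : KEdge n) :
    DefinesFacet (tspDiameterPolytope n)
      (concat₃ (edgeUnit e) (edgeUnit e) (-edgeUnit e)) 1 := by
  obtain ⟨r, hr, hre⟩ := exists_tour_notMem hn e
  obtain ⟨p, hp, hpe⟩ := exists_tour_mem (by omega) e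
  have hface : ∀ {x y z}, x ∈ tspFeasible n → y ∈ tspFeasible n → IsBinary z →
      x e + y e - z e = 1 → (∀ f, z f = 0 → x f = 0 ∨ y f = 0) →
      concat₃ x y z ∈ faceOf (tspDiameterPolytope n)
        (concat₃ (edgeUnit e) (edgeUnit e) (-edgeUnit e)) 1 :=
    fun hx hy hz hze h => concat₃_mem_of_tight hx hy hz (add_sub_le_one hx hy hz h)
      (by simpa [← sub_eq_add_neg])
  -- With the other tour `p` using `e`, tightness reads `z e = x e`. Thus `z = 1 - edgeUnit e + g
  -- x`, with entry `x e` at `e` and `1` elsewhere, stays on the face as `x` varies.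
  let g : (KEdge n → ℝ) →ₗ[ℝ] (KEdge n → ℝ) :=
    (LinearMap.single ℝ (fun _ => ℝ) e).comp (LinearMap.proj e)
  have hg : ∀ x, g x = Pi.single e (x e) := fun _ => rfl
  have hbin : ∀ {x}, x ∈ tspFeasible n → IsBinary (1 - edgeUnit e + g x) := by
    intro x hx f
    by_cases hfe : f = e
    · subst hfe
      simpa [edgeUnit, hg] using hx.1 f
    · simp [edgeUnit, hg, hfe]
  have hz : ∀ x f, (1 - edgeUnit e + g x) f = 0 → f = e ∧ x e = 0 := by
    intro x f hf
    by_cases hfe : f = e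
    · subst hfe
      exact ⟨rfl, by simpa [edgeUnit, hg] using hf⟩
    · simp [edgeUnit, hg, hfe] at hf
  have hleft : ∀ {x}, x ∈ tspFeasible n → concat₃ x p (1 - edgeUnit e + g x) ∈
      faceOf (tspDiameterPolytope n) (concat₃ (edgeUnit e) (edgeUnit e) (-edgeUnit e)) 1 :=
    fun hx => hface hx hp (hbin hx) (by simp [edgeUnit, hg, hpe]) fun f hf => by
      obtain ⟨rfl, h⟩ := hz _ f hf
      exact Or.inl h
  have hright : ∀ {y}, y ∈ tspFeasible n → concat₃ p y (1 - edgeUnit e + g y) ∈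
      faceOf (tspDiameterPolytope n) (concat₃ (edgeUnit e) (edgeUnit e) (-edgeUnit e)) 1 :=
    fun hy => hface hp hy (hbin hy) (by simp [edgeUnit, hg, hpe]) fun f hf => by
      obtain ⟨rfl, h⟩ := hz _ f hf
      exact Or.inr h
  refine definesFacet_of_vectorSpan (isValidIneq_convexHull ?_) (hleft hp)
    (concat₃_mem_of_mem_left (subset_convexHull ℝ _ hr) hr isBinary_one (tspFeasible.le_one hr))
    (by norm_num [concat₃_dotProduct_concat₃, hre]) (fun u hu hau => ?_)
  · rintro _ ⟨x, y, z, rfl, -, -, -, h⟩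
    simpa [concat₃_dotProduct_concat₃, ← sub_eq_add_neg] using h e
  · obtain ⟨u₁, u₂, u₃, rfl⟩ := exists_eq_concat₃ u
    obtain ⟨h₁, h₂⟩ := blocks_mem_vectorSpan hu
    rw [tspPolytope, vectorSpan_convexHull] at h₁ h₂
    have hue : u₁ e + u₂ e + -u₃ e = 0 := by simpa [concat₃_dotProduct_concat₃] using hau
    refine concat₃_mem_of_blocks g (fun x hx x' hx' => ?_) (fun y hy y' hy' => ?_) h₁ h₂
      (fun f hf => ?_)
    · simpa only [sub_self, add_sub_add_left_eq_sub] using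
        concat₃_sub_mem_vectorSpan (hleft hx) (hleft hx')
    · simpa only [sub_self, add_sub_add_left_eq_sub] using
        concat₃_sub_mem_vectorSpan (hright hy) (hright hy')
    -- At `e` the residual is `u₃ e - u₁ e - u₂ e`, which vanishes by orthogonality, so no flip at
    -- `e` is needed.
    · have hfe : f ≠ e := by
        rintro rfl
        apply hf
        simp only [Pi.sub_apply, hg, Pi.single_eq_same]
        linarith
      obtain ⟨x, hx, hxf⟩ := exists_tour_notMem hn f
      have hbin' : IsBinary (1 - edgeUnit e + g x - edgeUnit f) := by
        intro f'
        by_cases hff : f' = f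
        · subst hff
          simp [edgeUnit, hg, hfe]
        · simpa [edgeUnit, hff] using hbin hx f'
      have := concat₃_sub_mem_vectorSpan (hleft hx)
        (hface hx hp hbin' (by simp [edgeUnit, hg, hpe, hfe.symm]) fun f' hf' => by
          by_cases hff : f' = f
          · exact Or.inl (hff ▸ hxf)
          · obtain ⟨rfl, h⟩ := hz x f' (by simpa [edgeUnit, hff] using hf')
            exact Or.inl h)
      simpa only [sub_self, sub_sub_cancel, edgeUnit] using this

end Diameter

theorem mainTheorem12 (n : ℕ) (hn : 5 ≤ n) :
    -- lifts of the facets of the symmetric traveling salesman polytope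
    (∀ (a : KEdge n → ℝ) (a₀ : ℝ), DefinesFacet (tspPolytope n) a a₀ →
      DefinesFacet (tspDiameterPolytope n) (concat₃ a 0 0) a₀ ∧
      DefinesFacet (tspDiameterPolytope n) (concat₃ 0 a 0) a₀) ∧
    -- `z_e ≥ 0` (written `-z_e ≤ 0`) and `z_e ≤ 1`
    (∀ e : KEdge n,
      DefinesFacet (tspDiameterPolytope n) (concat₃ 0 0 (-edgeUnit e)) 0 ∧
      DefinesFacet (tspDiameterPolytope n) (concat₃ 0 0 (edgeUnit e)) 1) ∧
    -- `x_e + y_e - z_e ≤ 1`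
    (∀ e : KEdge n,
      DefinesFacet (tspDiameterPolytope n)
        (concat₃ (edgeUnit e) (edgeUnit e) (-edgeUnit e)) 1) := by
  have hn4 : 4 ≤ n := by omega
  exact ⟨fun a a₀ h => ⟨definesFacet_lift_left hn4 h, definesFacet_lift_middle hn4 h⟩,
    fun e => ⟨definesFacet_nonneg hn4 e, definesFacet_le_one hn4 e⟩,
    definesFacet_add_sub_le_one hn4⟩
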